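/- Let $C$ and $R$ be independent real-valued random variables with $C\ge 0$ and $R\ge 0$ almost surely, let $\alpha>0$ and $m\in\mathbb R$. Suppose that $0<E[C^\alpha\log C]<\infty$ (with $0^\alpha\log 0=0$), that the conditional distribution of $\log C$ given $C\neq 0$ is nonarithmetic (there is no $d>0$ such that it is concentrated on $d\mathbb Z$), that $m\,E[C^\alpha]=1$, and that $E[R^\beta]<\infty$ for every $0<\beta<\alpha$. If $$\int_0^\infty \bigl|P(R>t)-m\,P(CR>t)\bigr|\,t^{\alpha-1}\,dt<\infty,$$ then $$P(R>t)\sim H\,t^{-\alpha},\qquad t\to\infty,$$ in the sense that $\lim_{t\to\infty}t^{\alpha}P(R>t)=H$ (so that for $H=0$ the claim reads $P(R>t)=o(t^{-\alpha})$), where $H\ge 0$ is given by $$H=\frac{1}{m\,E[C^\alpha\log C]}\int_0^\infty v^{\alpha-1}\bigl(P(R>v)-m\,P(CR>v)\bigr)\,dv.$$ -/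

import Mathlib

open MeasureTheory ProbabilityTheory Filter Topology Set

/-- A measure `ν` on the real line is nonarithmetic if it is not concentrated on a set of the form
`d ℤ = {0, ±d, ±2d, …}` with `d > 0`. -/
def IsNonarithmetic (ν : Measure ℝ) : Prop :=
  ¬ ∃ d : ℝ, 0 < d ∧ ∀ᵐ x ∂ν, ∃ k : ℤ, x = k * d

/-! Put `r t = exp (α t) * P(R > exp t)` and let `η` be the law of `log C` under the density `m * C
^ α`, a probability measure with mean `m * E[C ^ α log C] > 0`. By independence the hypothesis says
that `g = r - η * r` is integrable, and `v = exp t` turns `H` into `(∫ g) / (∫ x dη)`. The claim is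
thus a renewal theorem: `r` tends to this constant.

It is proved without a renewal measure. Testing the equation against a suitable weight bounds `r`
(`exists_forall_le_of_integrable_sub_average`). With `V` a primitive of `r`, Fubini gives `∫_{-∞}^T
g = ∫ (V T - V (T - x)) dη`, which converges to `∫ g`. Differencing in `T` shows that the sliding
integrals of `r` are asymptotically `η`-invariant, hence, by a maximum principle and
nonarithmeticity, asymptotically invariant under all translations
(`tendsto_sub_shift_of_isNonarithmetic`). Since `exp (-α t) * r t` is nonincreasing, the same holds
for `r` itself (`tendsto_sub_shift_of_antitone_exp_mul`). Then `V T - V (T - x)` is close to `x * r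
T`, and dominated convergence yields `r T * ∫ x dη → ∫ g`. -/

/-! ### Laplace transform near zero -/

/-- The Laplace transform equals 1 at 0 and has right derivative minus the mean there, which is
negative. -/
lemma exists_integral_exp_neg_mul_lt_one {η : Measure ℝ} [IsProbabilityMeasure η] {ε₀ : ℝ}
    (hε₀ : 0 < ε₀) (hid : Integrable (fun x : ℝ => x) η) (hpos : 0 < ∫ x, x ∂η)
    (hexp : Integrable (fun x => Real.exp (-ε₀ * x)) η) :
    ∃ ε, 0 < ε ∧ ε ≤ ε₀ ∧ Integrable (fun x => Real.exp (-ε * x)) η ∧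
      ∫ x, Real.exp (-ε * x) ∂η < 1 := by
  have hint : ∀ ε, 0 < ε → ε ≤ ε₀ → Integrable (fun x => Real.exp (-ε * x)) η := by
    intro ε h0 h1
    refine ((integrable_const (1 : ℝ)).add hexp).mono' (by fun_prop) (ae_of_all _ fun x => ?_)
    rw [Real.norm_of_nonneg (Real.exp_pos _).le]
    simp only [Pi.add_apply]
    rcases le_total 0 x with hx | hx
    · have : Real.exp (-ε * x) ≤ 1 := Real.exp_le_one_iff.2 (by nlinarith)
      linarith [Real.exp_pos (-ε₀ * x)]
    · have : Real.exp (-ε * x) ≤ Real.exp (-ε₀ * x) := Real.exp_le_exp.2 (by nlinarith)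
      linarith
  have hlim : Tendsto (fun ε : ℝ => ∫ x, (1 - Real.exp (-ε * x)) / ε ∂η) (𝓝[>] 0)
      (𝓝 (∫ x, x ∂η)) := by
    refine tendsto_integral_filter_of_dominated_convergence
      (fun x => |x| + |(1 - Real.exp (-ε₀ * x)) / ε₀|) (.of_forall fun ε => by fun_prop) ?_ ?_ ?_
    · filter_upwards [Ioc_mem_nhdsGT hε₀] with ε hε
      obtain ⟨h0, h1⟩ := hε
      refine ae_of_all _ fun x => ?_
      have hu : (1 - Real.exp (-ε * x)) / ε ≤ x := by
        rw [div_le_iff₀ h0]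
        linarith [Real.add_one_le_exp (-ε * x)]
      -- The difference quotient at 0 of a concave function is nonincreasing in `ε`, so its value at
      -- `ε₀` is an integrable minorant.
      have hl : (1 - Real.exp (-ε₀ * x)) / ε₀ ≤ (1 - Real.exp (-ε * x)) / ε := by
        have hc := convexOn_exp.2 (mem_univ 0) (mem_univ (-ε₀ * x))
          (show 0 ≤ 1 - ε / ε₀ by rw [sub_nonneg, div_le_one hε₀]; exact h1)
          (show 0 ≤ ε / ε₀ by positivity) (by ring)
        simp only [smul_eq_mul, mul_zero, zero_add, Real.exp_zero, mul_one] at hc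
        rw [show ε / ε₀ * (-ε₀ * x) = -ε * x by field_simp] at hc
        rw [div_le_div_iff₀ hε₀ h0]
        have h2 := mul_le_mul_of_nonneg_right hc hε₀.le
        have h3 : (1 - ε / ε₀ + ε / ε₀ * Real.exp (-ε₀ * x)) * ε₀
            = ε₀ - ε + ε * Real.exp (-ε₀ * x) := by field_simp
        rw [h3] at h2
        linarith
      rw [Real.norm_eq_abs, abs_le]
      constructor
      · linarith [neg_abs_le ((1 - Real.exp (-ε₀ * x)) / ε₀), abs_nonneg x]
      · linarith [le_abs_self x, abs_nonneg ((1 - Real.exp (-ε₀ * x)) / ε₀)]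
    · exact hid.abs.add (((integrable_const (1 : ℝ)).sub hexp).div_const _).abs
    · refine ae_of_all _ fun x => ?_
      have hd : HasDerivAt (fun ε : ℝ => 1 - Real.exp (-ε * x)) x 0 := by
        have := (((hasDerivAt_id (0 : ℝ)).neg.mul_const x).exp).const_sub 1
        simpa using this
      have := (hasDerivAt_iff_tendsto_slope.1 hd).mono_left
        (nhdsWithin_mono _ (fun y (hy : 0 < y) => hy.ne'))
      refine this.congr fun ε => ?_
      simp [slope_def_field]
  have hev := (hlim.eventually_const_lt hpos).and (Ioc_mem_nhdsGT hε₀)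
  obtain ⟨ε, h1, h2, h3⟩ := hev.exists
  refine ⟨ε, h2, h3, hint ε h2 h3, ?_⟩
  rw [integral_div, integral_sub (integrable_const _) (hint ε h2 h3)] at h1
  have := (div_pos_iff_of_pos_right h2).1 h1
  simp at this
  simpa using this

/-! ### Asymptotic invariance under translations -/

/-- Approximate maximum principle: an average of values asymptotically at most `ℓ` can be close to
`ℓ` only if the values are close to `ℓ` near each point of the support. -/
lemma eventually_le_sub_of_almost_invariant {η : Measure ℝ} [IsProbabilityMeasure η]
    {D : ℝ → ℝ} {B ℓ a : ℝ} {L : NNReal} (hD : ∀ t, |D t| ≤ B) (hL : LipschitzWith L D)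
    (hinv : Tendsto (fun t => D t - ∫ x, D (t - x) ∂η) atTop (𝓝 0)) (ha : a ∈ η.support)
    (hup : ∀ τ > 0, ∀ᶠ t in atTop, D t ≤ ℓ + τ) (hB : |ℓ| ≤ B) {ε : ℝ} (hε : 0 < ε) :
    ∃ ε' > 0, ∀ᶠ t in atTop, ℓ - ε' ≤ D t → ℓ - ε ≤ D (t - a) := by
  have hB0 : 0 ≤ B := (abs_nonneg _).trans hB
  set ρ : ℝ := ε / (2 * (L + 1)) with hρ
  have hL1 : (0 : ℝ) < L + 1 := by positivity
  have hρ0 : 0 < ρ := by positivity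
  set p := η.real (Metric.ball a ρ) with hp
  have hp0 : 0 < p := by
    have := (Measure.mem_support_iff_forall a).1 ha _ (Metric.ball_mem_nhds a hρ0)
    exact ENNReal.toReal_pos this.ne' (measure_ne_top _ _)
  -- If the conclusion failed at `t`, then `ℓ + τ - D (t - x)` would have `η`-mean at least `p * ε /
  -- 2 - 2 * B * τ` and at most `3 * τ`. This `τ` makes the two incompatible.
  set τ := p * ε / (4 * (3 + 2 * B)) with hτ
  have hτ0 : 0 < τ := by positivity
  have hτe : (3 + 2 * B) * τ = p * ε / 4 := by rw [hτ]; field_simp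
  obtain ⟨T₀, hT₀⟩ := eventually_atTop.1 (hup τ hτ0)
  -- For `x > t - T₀` the bound `D (t - x) ≤ ℓ + τ` is not available; such `x` have small mass.
  have htail : ∀ᶠ t in atTop, η.real (Ioi (t - T₀)) < τ := by
    have h1 : Tendsto (fun t => η.real (Ioi (t - T₀))) atTop (𝓝 0) := by
      have h2 : Tendsto (fun t => 1 - cdf η (t - T₀)) atTop (𝓝 (1 - 1)) :=
        ((tendsto_cdf_atTop η).comp (tendsto_atTop_add_const_right _ (-T₀) tendsto_id)).const_sub 1
      rw [sub_self] at h2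
      refine h2.congr fun t => ?_
      rw [cdf_eq_real, ← compl_Iic, probReal_compl_eq_one_sub measurableSet_Iic]
    exact h1.eventually_lt_const hτ0
  refine ⟨τ, hτ0, ?_⟩
  filter_upwards [htail, hinv.eventually_lt_const hτ0, hinv.eventually_const_lt (neg_lt_zero.2 hτ0)]
    with t ht1 ht2 ht3 ht4
  by_contra! hlt
  have hDint : Integrable (fun x => D (t - x)) η := by
    refine Integrable.mono' (integrable_const B) ?_ (ae_of_all _ fun x => hD _)
    exact (hL.continuous.comp (by fun_prop : Continuous fun x : ℝ => t - x)).aestronglyMeasurable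
  have hlow : ∫ x, ((Metric.ball a ρ).indicator (fun _ => ε / 2) x
      - (Ioi (t - T₀)).indicator (fun _ => 2 * B) x) ∂η ≤ ∫ x, (ℓ + τ - D (t - x)) ∂η := by
    refine integral_mono (((integrable_const _).indicator Metric.isOpen_ball.measurableSet).sub
      ((integrable_const _).indicator measurableSet_Ioi)) ((integrable_const _).sub hDint) fun x => ?_
    simp only
    have hb : x ∈ Metric.ball a ρ → ε / 2 ≤ ℓ + τ - D (t - x) := by
      intro hx
      have h1 := hL.dist_le_mul (t - x) (t - a)
      rw [Real.dist_eq, Real.dist_eq, show t - x - (t - a) = -(x - a) by ring, abs_neg] at h1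
      rw [Metric.mem_ball, Real.dist_eq] at hx
      have h2 : (L : ℝ) * |x - a| ≤ ε / 2 := by
        calc (L : ℝ) * |x - a| ≤ (L + 1) * ρ := by gcongr; linarith
          _ = ε / 2 := by rw [hρ]; field_simp
      linarith [le_abs_self (D (t - x) - D (t - a))]
    have hall : -(2 * B) ≤ ℓ + τ - D (t - x) := by
      linarith [(abs_le.1 hB).1, (abs_le.1 (hD (t - x))).2]
    by_cases h1 : x ∈ Metric.ball a ρ <;> by_cases h2 : x ∈ Ioi (t - T₀) <;>
      simp only [h1, h2, indicator_of_mem, indicator_of_notMem, not_false_eq_true]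
    · linarith [hb h1]
    · linarith [hb h1]
    · linarith
    · have := hT₀ (t - x) (by simp at h2; linarith)
      linarith
  rw [integral_sub ((integrable_const _).indicator Metric.isOpen_ball.measurableSet)
      ((integrable_const _).indicator measurableSet_Ioi), integral_sub (integrable_const _) hDint,
    integral_indicator_const _ Metric.isOpen_ball.measurableSet,
    integral_indicator_const _ measurableSet_Ioi] at hlow
  simp only [smul_eq_mul, integral_const, probReal_univ, one_mul] at hlow
  have : η.real (Ioi (t - T₀)) * (2 * B) ≤ τ * (2 * B) := by gcongr
  have : 0 < p * ε := by positivity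
  rw [← hp] at hlow
  nlinarith

lemma eventually_forall_le_sub_of_almost_invariant {η : Measure ℝ} [IsProbabilityMeasure η]
    {D : ℝ → ℝ} {B ℓ a : ℝ} {L : NNReal} (hD : ∀ t, |D t| ≤ B) (hL : LipschitzWith L D)
    (hinv : Tendsto (fun t => D t - ∫ x, D (t - x) ∂η) atTop (𝓝 0)) (ha : a ∈ η.support)
    (hup : ∀ τ > 0, ∀ᶠ t in atTop, D t ≤ ℓ + τ) (hB : |ℓ| ≤ B) (N : ℕ) {ε : ℝ} (hε : 0 < ε) :
    ∃ ε' > 0, ∀ᶠ t in atTop, ℓ - ε' ≤ D t → ∀ k < N, ℓ - ε ≤ D (t - k * a) := by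
  induction N with
  | zero => exact ⟨1, one_pos, .of_forall fun t _ k hk => absurd hk (Nat.not_lt_zero _)⟩
  | succ N ih =>
    obtain ⟨ε₁, h1, ht1⟩ := ih
    obtain ⟨ε₂, h2, ht2⟩ := eventually_le_sub_of_almost_invariant hD hL hinv ha hup hB h1
    -- `ε₂` carries closeness from `t` to `t - a`, where the induction hypothesis takes over; `ε`
    -- serves `k = 0`.
    refine ⟨min ε₂ ε, lt_min h2 hε, ?_⟩
    have ht3 := (tendsto_atTop_add_const_right atTop (-a) tendsto_id).eventually ht1
    filter_upwards [ht2, ht3] with t h3 h4 h5 k hk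
    rcases k with _ | k
    · have := min_le_right ε₂ ε
      simp only [Nat.cast_zero, zero_mul, sub_zero]; linarith
    · have := h4 (by simpa [sub_eq_add_neg] using h3 (by linarith [min_le_left ε₂ ε])) k (by omega)
      simp only [id] at this
      rw [show t - ((k + 1 : ℕ) : ℝ) * a = t + -a - k * a by push_cast; ring]
      exact this

/-- The increment `D t = s t - s (t - a)` inherits asymptotic invariance. A positive limsup would,
by the maximum principle, produce arbitrarily long runs of increments bounded below, and their
telescoping sum would contradict the boundedness of `s`. -/
lemma eventually_sub_shift_lt {η : Measure ℝ} [IsProbabilityMeasure η]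
    {s : ℝ → ℝ} {B a : ℝ} {L : NNReal} (hs : ∀ t, |s t| ≤ B) (hL : LipschitzWith L s)
    (hinv : Tendsto (fun t => s t - ∫ x, s (t - x) ∂η) atTop (𝓝 0)) (ha : a ∈ η.support)
    {κ : ℝ} (hκ : 0 < κ) : ∀ᶠ t in atTop, s t - s (t - a) < κ := by
  set D : ℝ → ℝ := fun t => s t - s (t - a) with hDdef
  have hD : ∀ t, |D t| ≤ 2 * B := fun t =>
    (abs_sub _ _).trans (by linarith [hs t, hs (t - a)])
  have hDL : LipschitzWith (L + L) D := by
    refine LipschitzWith.of_dist_le_mul fun x y => ?_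
    have h1 := hL.dist_le_mul x y
    have h2 := hL.dist_le_mul (x - a) (y - a)
    rw [dist_sub_right] at h2
    have h3 := dist_sub_sub_le (s x) (s (x - a)) (s y) (s (y - a))
    push_cast
    simp only [hDdef]
    linarith
  have hsint : ∀ t, Integrable (fun x => s (t - x)) η := fun t => by
    refine Integrable.mono' (integrable_const B) ?_ (ae_of_all _ fun x => hs _)
    exact (hL.continuous.comp (by fun_prop : Continuous fun x : ℝ => t - x)).aestronglyMeasurable
  have hDinv : Tendsto (fun t => D t - ∫ x, D (t - x) ∂η) atTop (𝓝 0) := by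
    have h1 := hinv.sub (hinv.comp (tendsto_atTop_add_const_right atTop (-a) tendsto_id))
    rw [sub_self] at h1
    refine h1.congr fun t => ?_
    have h2 : ∀ x, t - x - a = t - a - x := fun x => by ring
    simp only [hDdef, Function.comp, id, h2, ← sub_eq_add_neg]
    rw [integral_sub (hsint t) (hsint (t - a))]
    ring
  have hbdd : IsBoundedUnder (· ≤ ·) atTop D := isBoundedUnder_of ⟨2 * B, fun t => (abs_le.1 (hD t)).2⟩
  have hcobdd : IsCoboundedUnder (· ≤ ·) atTop D :=
    (isBoundedUnder_of ⟨-(2 * B), fun t => (abs_le.1 (hD t)).1⟩ :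
      IsBoundedUnder (· ≥ ·) atTop D).isCoboundedUnder_le
  set ℓ := limsup D atTop with hℓ
  suffices hle : ℓ ≤ 0 from eventually_lt_of_limsup_lt (hle.trans_lt hκ) hbdd
  by_contra! hpos
  have hup : ∀ τ > 0, ∀ᶠ t in atTop, D t ≤ ℓ + τ := fun τ hτ =>
    (eventually_lt_of_limsup_lt (lt_add_of_pos_right ℓ hτ) hbdd).mono fun _ h => h.le
  have hℓB : |ℓ| ≤ 2 * B := by
    rw [abs_of_pos hpos]
    exact limsup_le_of_le hcobdd (.of_forall fun t => (abs_le.1 (hD t)).2)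
  obtain ⟨N, hN⟩ := exists_nat_gt (2 * B / (ℓ / 2))
  rw [div_lt_iff₀ (by positivity)] at hN
  obtain ⟨ε', hε', hev⟩ := eventually_forall_le_sub_of_almost_invariant hD hDL hDinv ha hup hℓB N
    (half_pos hpos)
  have hfr := frequently_lt_of_lt_limsup hcobdd (sub_lt_self ℓ hε')
  obtain ⟨t, ht1, ht2⟩ := (hfr.and_eventually hev).exists
  have hk := ht2 ht1.le
  have htel : s t - s (t - N * a) = ∑ k ∈ Finset.range N, D (t - k * a) := by
    have := Finset.sum_range_sub' (fun k : ℕ => s (t - k * a)) N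
    simp only [Nat.cast_zero, zero_mul, sub_zero] at this
    rw [← this]
    refine Finset.sum_congr rfl fun k _ => ?_
    simp only [hDdef]
    push_cast
    congr 2
    ring
  have hsum : (N : ℝ) * (ℓ / 2) ≤ ∑ k ∈ Finset.range N, D (t - k * a) := by
    have := Finset.card_nsmul_le_sum (Finset.range N) (fun k : ℕ => D (t - k * a)) (ℓ / 2)
      (fun k hk' => by have := hk k (Finset.mem_range.1 hk'); linarith)
    simpa using this
  linarith [(abs_le.1 (hs t)).2, (abs_le.1 (hs (t - N * a))).1]

lemma tendsto_sub_shift_of_mem_support {η : Measure ℝ} [IsProbabilityMeasure η]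
    {s : ℝ → ℝ} {B a : ℝ} {L : NNReal} (hs : ∀ t, |s t| ≤ B) (hL : LipschitzWith L s)
    (hinv : Tendsto (fun t => s t - ∫ x, s (t - x) ∂η) atTop (𝓝 0)) (ha : a ∈ η.support) :
    Tendsto (fun t => s t - s (t - a)) atTop (𝓝 0) := by
  refine tendsto_order.2 ⟨fun κ hκ => ?_, fun κ hκ => eventually_sub_shift_lt hs hL hinv ha hκ⟩
  have hinv' : Tendsto (fun t => -s t - ∫ x, -s (t - x) ∂η) atTop (𝓝 0) := by
    have := hinv.neg
    rw [neg_zero] at this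
    refine this.congr fun t => ?_
    rw [integral_neg]; ring
  have := eventually_sub_shift_lt (s := fun t => -s t) (fun t => by rw [abs_neg]; exact hs t)
    hL.neg hinv' ha (neg_pos.2 hκ)
  filter_upwards [this] with t ht
  linarith

/-- A bounded Lipschitz function that is asymptotically invariant under averaging against a
nonarithmetic probability measure is asymptotically invariant under every translation. -/
lemma tendsto_sub_shift_of_isNonarithmetic {η : Measure ℝ} [IsProbabilityMeasure η]
    (hη : IsNonarithmetic η) {s : ℝ → ℝ} {B : ℝ} {L : NNReal} (hs : ∀ t, |s t| ≤ B)
    (hL : LipschitzWith L s)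
    (hinv : Tendsto (fun t => s t - ∫ x, s (t - x) ∂η) atTop (𝓝 0)) (a : ℝ) :
    Tendsto (fun t => s t - s (t - a)) atTop (𝓝 0) := by
  -- The asymptotic periods of `s` form a subgroup containing the support of `η`. If dense, it is
  -- everything by the Lipschitz bound; if cyclic, `η` would be arithmetic.
  let A : AddSubgroup ℝ :=
    { carrier := {a | Tendsto (fun t => s t - s (t - a)) atTop (𝓝 0)}
      zero_mem' := by simp
      add_mem' := by
        intro a b ha hb
        have h1 := ha.add (hb.comp (tendsto_atTop_add_const_right atTop (-a) tendsto_id))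
        rw [add_zero] at h1
        refine h1.congr fun t => ?_
        simp only [Function.comp, id]
        rw [show t + -a - b = t - (a + b) by ring, ← sub_eq_add_neg]
        ring
      neg_mem' := by
        intro a ha
        have h1 := (ha.comp (tendsto_atTop_add_const_right atTop a tendsto_id)).neg
        rw [neg_zero] at h1
        refine h1.congr fun t => ?_
        simp [Function.comp] }
  have hA : ∀ x, x ∈ A ↔ Tendsto (fun t => s t - s (t - x)) atTop (𝓝 0) := fun x => Iff.rfl
  have hsupp : η.support ⊆ A := fun x hx => tendsto_sub_shift_of_mem_support hs hL hinv hx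
  rcases AddSubgroup.dense_or_cyclic A with hd | ⟨d, hd⟩
  · rw [Metric.tendsto_nhds]
    intro ε hε
    have hL1 : (0 : ℝ) < L + 1 := by positivity
    obtain ⟨b, hb, hbA⟩ := Metric.dense_iff.1 hd a (ε / (2 * (L + 1))) (by positivity)
    filter_upwards [Metric.tendsto_nhds.1 ((hA b).1 hbA) (ε / 2) (half_pos hε)] with t ht
    rw [Real.dist_eq, sub_zero] at ht ⊢
    have h1 := hL.dist_le_mul (t - b) (t - a)
    rw [Real.dist_eq, Real.dist_eq, show t - b - (t - a) = -(b - a) by ring, abs_neg] at h1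
    rw [Metric.mem_ball, Real.dist_eq] at hb
    have h2 : (L : ℝ) * |b - a| ≤ ε / 2 := by
      calc (L : ℝ) * |b - a| ≤ (L + 1) * (ε / (2 * (L + 1))) := by gcongr; linarith
        _ = ε / 2 := by field_simp
    have h3 := abs_add_le (s t - s (t - b)) (s (t - b) - s (t - a))
    rw [show s t - s (t - b) + (s (t - b) - s (t - a)) = s t - s (t - a) by ring] at h3
    linarith
  · exfalso
    apply hη
    -- The generator may be zero or negative; when it is zero, `η` sits at 0 and any positive span
    -- will do.
    refine ⟨if d = 0 then 1 else |d|, by split_ifs with h <;> [exact one_pos; exact abs_pos.2 h], ?_⟩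
    filter_upwards [Measure.support_mem_ae (μ := η)] with x hx
    have hxA : x ∈ A := hsupp hx
    rw [hd, AddSubgroup.mem_closure_singleton] at hxA
    obtain ⟨k, hk⟩ := hxA
    rw [zsmul_eq_mul] at hk
    split_ifs with h
    · exact ⟨0, by rw [← hk, h]; simp⟩
    · rcases abs_choice d with h' | h' <;> rw [h']
      · exact ⟨k, hk.symm⟩
      · exact ⟨-k, by rw [← hk]; push_cast; ring⟩

/-! ### A priori boundedness -/

lemma ofReal_le_lintegral_average {η : Measure ℝ} {r : ℝ → ℝ} (hr0 : ∀ t, 0 ≤ r t) (t : ℝ) :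
    ENNReal.ofReal (r t) ≤ ‖r t - ∫ x, r (t - x) ∂η‖ₑ
      + ∫⁻ x, ENNReal.ofReal (r (t - x)) ∂η := by
  have h1 : ENNReal.ofReal (∫ x, r (t - x) ∂η) ≤ ∫⁻ x, ENNReal.ofReal (r (t - x)) ∂η := by
    by_cases hi : Integrable (fun x => r (t - x)) η
    · rw [ofReal_integral_eq_lintegral_ofReal hi (ae_of_all _ fun x => hr0 _)]
    · simp [integral_undef hi]
  calc ENNReal.ofReal (r t)
      ≤ ENNReal.ofReal (|r t - ∫ x, r (t - x) ∂η| + ∫ x, r (t - x) ∂η) := by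
        apply ENNReal.ofReal_le_ofReal
        linarith [le_abs_self (r t - ∫ x, r (t - x) ∂η)]
    _ ≤ _ := by
        refine ENNReal.ofReal_add_le.trans (add_le_add ?_ h1)
        rw [← Real.norm_eq_abs, ofReal_norm]

/-- The weight `F u = min (exp (ε u)) 1` is strictly superharmonic on `u < 0`: averaging it against
`η` loses at least `J u = (1 - φ) * exp (ε u)` there. Pairing `r - η * r` with `F (t - ·)` therefore
bounds `∫ r (t - u) * J u` by the L¹ norm, uniformly in `t`, and monotonicity turns this local
integral bound into a pointwise one. -/
lemma exists_forall_le_of_integrable_sub_average {η : Measure ℝ} [IsProbabilityMeasure η]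
    {r : ℝ → ℝ} {α ε ε' K : ℝ} (hα : 0 < α) (hε : 0 < ε) (hεε : ε' < ε)
    (hr0 : ∀ t, 0 ≤ r t) (hmeas : Measurable r)
    (hanti : Antitone fun t => Real.exp (-α * t) * r t)
    (hr1 : ∀ t, r t ≤ Real.exp (α * t)) (hrK : ∀ t, r t ≤ K * Real.exp (ε' * t))
    (hexp : Integrable (fun x => Real.exp (-ε * x)) η) (hφ : ∫ x, Real.exp (-ε * x) ∂η < 1)
    (hg : Integrable fun t => r t - ∫ x, r (t - x) ∂η) :
    ∃ B, ∀ t, r t ≤ B := by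
  set φ := ∫ x, Real.exp (-ε * x) ∂η with hφdef
  have hφ0 : 0 ≤ φ := integral_nonneg fun x => (Real.exp_pos _).le
  set q : ℝ → ENNReal := fun t => ENNReal.ofReal (r t) with hq
  have hqm : Measurable q := hmeas.ennreal_ofReal
  set F : ℝ → ENNReal := fun u => ENNReal.ofReal (min (Real.exp (ε * u)) 1) with hF
  have hFm : Measurable F := by fun_prop
  set F' : ℝ → ENNReal := fun u => if u < 0 then ENNReal.ofReal (φ * Real.exp (ε * u)) else 1
    with hF'
  have hF'm : Measurable F' := Measurable.ite measurableSet_Iio (by fun_prop) measurable_const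
  set J : ℝ → ENNReal := fun u => if u < 0 then ENNReal.ofReal ((1 - φ) * Real.exp (ε * u)) else 0
    with hJ
  have hJm : Measurable J := Measurable.ite measurableSet_Iio (by fun_prop) measurable_const
  have hsplit : ∀ u, F u = F' u + J u := by
    intro u
    simp only [hF, hF', hJ]
    split_ifs with h
    · rw [← ENNReal.ofReal_add (by positivity) (mul_nonneg (by linarith) (Real.exp_pos _).le),
        min_eq_left (Real.exp_le_one_iff.2 (by nlinarith))]
      ring_nf
    · rw [min_eq_right (Real.one_le_exp (mul_nonneg hε.le (not_lt.1 h)))]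
      simp
  have hF1 : ∀ u, F u ≤ 1 := fun u => by
    simp only [hF]
    exact ENNReal.ofReal_le_one.2 (min_le_right _ _)
  have havg : ∀ w, ∫⁻ x, F (w - x) ∂η ≤ F' w := by
    intro w
    simp only [hF']
    split_ifs with h
    · calc ∫⁻ x, F (w - x) ∂η
          ≤ ∫⁻ x, ENNReal.ofReal (Real.exp (ε * w) * Real.exp (-ε * x)) ∂η := by
            refine lintegral_mono fun x => ENNReal.ofReal_le_ofReal ?_
            rw [← Real.exp_add]
            refine (min_le_left _ _).trans (le_of_eq ?_)
            ring_nf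
        _ = ENNReal.ofReal (φ * Real.exp (ε * w)) := by
            rw [← ofReal_integral_eq_lintegral_ofReal (hexp.const_mul _)
              (ae_of_all _ fun x => by positivity), integral_const_mul, mul_comm]
    · calc ∫⁻ x, F (w - x) ∂η ≤ ∫⁻ _, 1 ∂η := lintegral_mono fun x => hF1 _
        _ = 1 := by simp
  -- Finiteness permits the later cancellation. On `u ≤ 0` the growth rate `ε'` of `r` is beaten by
  -- the decay rate `ε` of `F`; on `u > 0` the bound `exp (α (t - u))` suffices.
  have hfin : ∀ t, ∫⁻ u, q (t - u) * F u ≠ ⊤ := by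
    intro t
    rw [← lintegral_add_compl _ (measurableSet_Iic (a := (0 : ℝ)))]
    refine ENNReal.add_ne_top.2 ⟨ne_top_of_le_ne_top ?_ (setLIntegral_mono (g := fun u =>
      ENNReal.ofReal (K * Real.exp (ε' * t) * Real.exp ((ε - ε') * u))) (by fun_prop) ?_),
      ne_top_of_le_ne_top ?_ (setLIntegral_mono (g := fun u =>
      ENNReal.ofReal (Real.exp (α * t) * Real.exp (-α * u))) (by fun_prop) ?_)⟩
    · exact ((integrableOn_exp_mul_Iic (sub_pos.2 hεε) 0).const_mul _).lintegral_lt_top.ne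
    · intro u _
      simp only [hq, hF]
      rw [← ENNReal.ofReal_mul (hr0 _)]
      apply ENNReal.ofReal_le_ofReal
      calc r (t - u) * min (Real.exp (ε * u)) 1
          ≤ (K * Real.exp (ε' * (t - u))) * Real.exp (ε * u) := by
            refine mul_le_mul (hrK _) (min_le_left _ _) (by positivity) ((hr0 _).trans (hrK _))
        _ = _ := by
            rw [mul_assoc, mul_assoc, ← Real.exp_add, ← Real.exp_add]; ring_nf
    · rw [compl_Iic]
      exact ((integrableOn_exp_mul_Ioi (neg_lt_zero.2 hα) 0).const_mul _).lintegral_lt_top.ne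
    · intro u _
      calc q (t - u) * F u ≤ q (t - u) := mul_le_of_le_one_right' (hF1 u)
        _ ≤ _ := by
          apply ENNReal.ofReal_le_ofReal
          refine (hr1 _).trans (le_of_eq ?_)
          rw [← Real.exp_add]; ring_nf
  set N := ∫⁻ t, ‖r t - ∫ x, r (t - x) ∂η‖ₑ with hN
  have hNtop : N ≠ ⊤ := hg.2.ne
  have hkey : ∀ t, ∫⁻ u, q (t - u) * J u ≤ N := by
    intro t
    have h1 : ∫⁻ u, q (t - u) * F u = (∫⁻ u, q (t - u) * F' u) + ∫⁻ u, q (t - u) * J u := by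
      rw [← lintegral_add_left (by fun_prop)]
      simp_rw [hsplit, mul_add]
    have hswap : ∫⁻ u, (∫⁻ x, q (t - u - x) ∂η) * F u ≤ ∫⁻ u, q (t - u) * F' u := by
      calc ∫⁻ u, (∫⁻ x, q (t - u - x) ∂η) * F u
          = ∫⁻ u, ∫⁻ x, q (t - u - x) * F u ∂η := by
            refine lintegral_congr fun u => ?_
            rw [lintegral_mul_const _ (by fun_prop)]
        _ = ∫⁻ x, (∫⁻ u, q (t - u - x) * F u) ∂η :=
            lintegral_lintegral_swap (f := fun u x => q (t - u - x) * F u)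
              (by fun_prop : Measurable _).aemeasurable
        _ = ∫⁻ x, (∫⁻ w, q (t - w) * F (w - x)) ∂η := by
            refine lintegral_congr fun x => ?_
            rw [← lintegral_sub_right_eq_self (μ := volume) (fun u => q (t - u - x) * F u) x]
            refine lintegral_congr fun w => ?_
            rw [show t - (w - x) - x = t - w by ring]
        _ = ∫⁻ w, ∫⁻ x, q (t - w) * F (w - x) ∂η :=
            lintegral_lintegral_swap (f := fun x w => q (t - w) * F (w - x))
              (by fun_prop : Measurable _).aemeasurable
        _ ≤ ∫⁻ u, q (t - u) * F' u := by
            refine lintegral_mono fun w => ?_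
            rw [lintegral_const_mul _ (by fun_prop)]
            gcongr
            exact havg w
    have h2 : ∫⁻ u, q (t - u) * F u ≤ N + ∫⁻ u, q (t - u) * F' u := by
      calc ∫⁻ u, q (t - u) * F u
          ≤ ∫⁻ u, (‖r (t - u) - ∫ x, r (t - u - x) ∂η‖ₑ
              + (∫⁻ x, q (t - u - x) ∂η) * F u) := by
            refine lintegral_mono fun u => ?_
            calc q (t - u) * F u ≤ (‖r (t - u) - ∫ x, r (t - u - x) ∂η‖ₑ
                  + ∫⁻ x, q (t - u - x) ∂η) * F u := by
                  gcongr
                  exact ofReal_le_lintegral_average hr0 _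
              _ ≤ _ := by
                  rw [add_mul]
                  gcongr
                  exact mul_le_of_le_one_right' (hF1 u)
        _ = (∫⁻ u, ‖r (t - u) - ∫ x, r (t - u - x) ∂η‖ₑ)
              + ∫⁻ u, (∫⁻ x, q (t - u - x) ∂η) * F u := by
            refine lintegral_add_right _ ?_
            refine Measurable.mul ?_ hFm
            exact Measurable.lintegral_prod_right' (f := fun p : ℝ × ℝ => q (t - p.1 - p.2))
              (by fun_prop)
        _ ≤ _ := by
            rw [lintegral_sub_left_eq_self (fun s => ‖r s - ∫ x, r (s - x) ∂η‖ₑ) t]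
            gcongr
    rw [h1, add_comm N] at h2
    have hne : ∫⁻ u, q (t - u) * F' u ≠ ⊤ := fun h => hfin t (by rw [h1, h, top_add])
    exact (ENNReal.add_le_add_iff_left hne).1 h2
  have hc : 0 < Real.exp (-α) * ((1 - φ) * Real.exp (-ε)) := by
    have : 0 < 1 - φ := by linarith
    positivity
  -- For `u` in `(-1, 0)`, `r (s - 1 - u) ≥ exp (-α) * r s` and `J u ≥ (1 - φ) * exp (-ε)`.
  refine ⟨N.toReal / (Real.exp (-α) * ((1 - φ) * Real.exp (-ε))), fun s => ?_⟩
  rw [le_div_iff₀ hc]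
  have h1 : ENNReal.ofReal (r s * (Real.exp (-α) * ((1 - φ) * Real.exp (-ε)))) ≤ N := by
    calc ENNReal.ofReal (r s * (Real.exp (-α) * ((1 - φ) * Real.exp (-ε))))
        = ∫⁻ _ in Ioo (-1 : ℝ) 0,
            ENNReal.ofReal (r s * (Real.exp (-α) * ((1 - φ) * Real.exp (-ε)))) := by simp
      _ ≤ ∫⁻ u in Ioo (-1 : ℝ) 0, q (s - 1 - u) * J u := by
          refine setLIntegral_mono (by fun_prop) fun u hu => ?_
          simp only [hq, hJ, hu.2, if_true]
          rw [← ENNReal.ofReal_mul (hr0 _), ← mul_assoc]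
          apply ENNReal.ofReal_le_ofReal
          have h2 := hanti (show s - 1 - u ≤ s by linarith [hu.1])
          simp only at h2
          have h3 : r s * Real.exp (-α) ≤ r (s - 1 - u) := by
            calc r s * Real.exp (-α)
                = Real.exp (α * s - α) * (Real.exp (-α * s) * r s) := by
                  rw [← mul_assoc, ← Real.exp_add]; ring_nf
              _ ≤ Real.exp (α * s - α) * (Real.exp (-α * (s - 1 - u)) * r (s - 1 - u)) := by
                  gcongr
              _ = Real.exp (α * u) * r (s - 1 - u) := by
                  rw [← mul_assoc, ← Real.exp_add]; ring_nf
              _ ≤ 1 * r (s - 1 - u) := by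
                  gcongr
                  · exact hr0 _
                  · exact Real.exp_le_one_iff.2 (by nlinarith [hu.2])
              _ = _ := one_mul _
          have h4 : (1 - φ) * Real.exp (-ε) ≤ (1 - φ) * Real.exp (ε * u) :=
            mul_le_mul_of_nonneg_left (Real.exp_le_exp.2 (by nlinarith [hu.1])) (by linarith)
          exact mul_le_mul h3 h4 (mul_nonneg (by linarith) (Real.exp_pos _).le) (hr0 _)
      _ ≤ ∫⁻ u, q (s - 1 - u) * J u := setLIntegral_le_lintegral _ _
      _ ≤ N := hkey _
  exact (ENNReal.ofReal_le_iff_le_toReal hNtop).1 h1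

/-! ### The renewal theorem -/

lemma setIntegral_Iic_comp_sub_right (f : ℝ → ℝ) (T x : ℝ) :
    ∫ u in Iic T, f (u - x) = ∫ u in Iic (T - x), f u := by
  have := (measurePreserving_sub_right volume x).setIntegral_preimage_emb
    (MeasurableEquiv.subRight x).measurableEmbedding f (Iic (T - x))
  rw [← this]
  congr 2
  ext u
  simp

lemma setIntegral_Iic_sub_average {η : Measure ℝ} [IsProbabilityMeasure η]
    {f : ℝ → ℝ} {ε K : ℝ} (hε : 0 < ε) (hf0 : ∀ t, 0 ≤ f t) (hmeas : Measurable f)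
    (hfK : ∀ t, f t ≤ K * Real.exp (ε * t))
    (hexp : Integrable (fun x => Real.exp (-ε * x)) η) (T : ℝ) :
    ∫ u in Iic T, (f u - ∫ x, f (u - x) ∂η) = ∫ x, (∫ u in (T - x)..T, f u) ∂η := by
  have hshift : ∀ u x, f (u - x) ≤ K * Real.exp (ε * u) * Real.exp (-ε * x) := fun u x => by
    refine (hfK _).trans (le_of_eq ?_)
    rw [mul_assoc, ← Real.exp_add]; ring_nf
  have hint : ∀ u, Integrable (fun x => f (u - x)) η := fun u =>
    (hexp.const_mul (K * Real.exp (ε * u))).mono'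
      (by fun_prop : Measurable fun x => f (u - x)).aestronglyMeasurable
      (ae_of_all _ fun x => by rw [Real.norm_of_nonneg (hf0 _)]; exact hshift u x)
  have hIic : ∀ S, IntegrableOn f (Iic S) := fun S =>
    ((integrableOn_exp_mul_Iic hε S).const_mul K).mono' hmeas.aestronglyMeasurable
      (ae_of_all _ fun x => by rw [Real.norm_of_nonneg (hf0 _)]; exact hfK x)
  have hprod : Integrable (Function.uncurry fun u x => f u - f (u - x))
      ((volume.restrict (Iic T)).prod η) := by
    have hdom := ((integrableOn_exp_mul_Iic hε T).const_mul K).mul_prod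
      ((integrable_const (1 : ℝ)).add hexp)
    refine hdom.mono' (by fun_prop : Measurable _).aestronglyMeasurable (ae_of_all _ fun ⟨u, x⟩ => ?_)
    simp only [Function.uncurry, Real.norm_eq_abs, Pi.add_apply]
    have h1 := hfK u
    have h2 := hshift u x
    have h3 := hf0 u
    have h4 := hf0 (u - x)
    rw [abs_le]
    constructor <;> nlinarith
  calc ∫ u in Iic T, (f u - ∫ x, f (u - x) ∂η)
      = ∫ u in Iic T, ∫ x, (f u - f (u - x)) ∂η := by
        refine integral_congr_ae (ae_of_all _ fun u => ?_)
        simp only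
        rw [integral_sub (integrable_const _) (hint u)]
        simp
    _ = ∫ x, (∫ u in Iic T, (f u - f (u - x))) ∂η := integral_integral_swap hprod
    _ = _ := by
        refine integral_congr_ae (ae_of_all _ fun x => ?_)
        simp only
        have hs : IntegrableOn (fun u => f (u - x)) (Iic T) := by
          refine ((integrableOn_exp_mul_Iic hε T).const_mul (K * Real.exp (-ε * x))).mono'
            (by fun_prop : Measurable fun u => f (u - x)).aestronglyMeasurable (ae_of_all _ fun u => ?_)
          rw [Real.norm_of_nonneg (hf0 _)]
          exact (hshift u x).trans (le_of_eq (by ring))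
        rw [integral_sub (hIic T) hs, setIntegral_Iic_comp_sub_right,
          intervalIntegral.integral_Iic_sub_Iic (hIic _) (hIic _)]

/-- A Tauberian step: over an interval of length `δ`, `r` can increase by a factor of at most `exp
(α δ)`, so its values compare with its means over short intervals. -/
lemma tendsto_sub_shift_of_antitone_exp_mul {r : ℝ → ℝ} {α B : ℝ} (hα : 0 < α)
    (hr0 : ∀ t, 0 ≤ r t) (hB : ∀ t, r t ≤ B)
    (hanti : Antitone fun t => Real.exp (-α * t) * r t)
    (hint : ∀ a b, IntervalIntegrable r volume a b)
    (hslow : ∀ δ a : ℝ, Tendsto (fun t => (∫ u in (t - δ)..t, r u)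
      - ∫ u in (t - a - δ)..(t - a), r u) atTop (𝓝 0)) (a : ℝ) :
    Tendsto (fun t => r t - r (t - a)) atTop (𝓝 0) := by
  have hmono : ∀ {u t : ℝ}, u ≤ t → r t ≤ Real.exp (α * (t - u)) * r u := by
    intro u t hut
    have h1 := mul_le_mul_of_nonneg_left (hanti hut) (Real.exp_pos (α * t)).le
    simp only at h1
    rw [← mul_assoc, ← mul_assoc, ← Real.exp_add, ← Real.exp_add] at h1
    rw [show α * t + -α * t = 0 by ring, Real.exp_zero, one_mul,
      show α * t + -α * u = α * (t - u) by ring] at h1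
    exact h1
  have key : ∀ a κ : ℝ, 0 < κ → ∀ᶠ t in atTop, r t - r (t - a) < κ := by
    intro a κ hκ
    have hcont : Tendsto (fun δ : ℝ => (Real.exp (α * δ) - Real.exp (-α * δ)) * B)
        (𝓝[>] 0) (𝓝 0) := by
      have : Continuous fun δ : ℝ => (Real.exp (α * δ) - Real.exp (-α * δ)) * B := by fun_prop
      simpa using (this.tendsto 0).mono_left nhdsWithin_le_nhds
    obtain ⟨δ, hδκ, hδ⟩ := ((hcont.eventually_lt_const (half_pos hκ)).and
      (self_mem_nhdsWithin (s := Ioi (0 : ℝ)))).exists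
    replace hδ : 0 < δ := hδ
    have hE : 0 < Real.exp (α * δ) / δ := by positivity
    filter_upwards [(hslow δ (a - δ)).eventually_lt_const
      (div_pos (half_pos hκ) hE)] with t ht
    rw [lt_div_iff₀ hE] at ht
    set S₁ := ∫ u in (t - δ)..t, r u
    set S₂ := ∫ u in (t - (a - δ) - δ)..(t - (a - δ)), r u
    have h1 : δ * r t ≤ Real.exp (α * δ) * S₁ := by
      have : ∫ _ in (t - δ)..t, Real.exp (-α * δ) * r t ≤ S₁ := by
        refine intervalIntegral.integral_mono_on (by linarith) (by simp) (hint _ _) fun u hu => ?_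
        have := hmono hu.2
        calc Real.exp (-α * δ) * r t
            ≤ Real.exp (-α * δ) * (Real.exp (α * δ) * r u) := by
              gcongr
              refine this.trans ?_
              gcongr
              · exact hr0 u
              · linarith [hu.1]
          _ = r u := by rw [← mul_assoc, ← Real.exp_add]; simp
      rw [intervalIntegral.integral_const, smul_eq_mul, sub_sub_cancel] at this
      calc δ * r t = Real.exp (α * δ) * (δ * (Real.exp (-α * δ) * r t)) := by
            rw [show Real.exp (α * δ) * (δ * (Real.exp (-α * δ) * r t))
              = (Real.exp (α * δ) * Real.exp (-α * δ)) * (δ * r t) by ring, ← Real.exp_add]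
            simp
        _ ≤ _ := by gcongr
    have h2 : Real.exp (-α * δ) * S₂ ≤ δ * r (t - a) := by
      have : S₂ ≤ ∫ _ in (t - (a - δ) - δ)..(t - (a - δ)), Real.exp (α * δ) * r (t - a) := by
        refine intervalIntegral.integral_mono_on (by linarith) (hint _ _) (by simp) fun u hu => ?_
        refine (hmono (u := t - a) (by linarith [hu.1])).trans ?_
        gcongr
        · exact hr0 _
        · linarith [hu.2]
      rw [intervalIntegral.integral_const, smul_eq_mul, sub_sub_cancel] at this
      calc Real.exp (-α * δ) * S₂
          ≤ Real.exp (-α * δ) * (δ * (Real.exp (α * δ) * r (t - a))) := by gcongr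
        _ = (Real.exp (-α * δ) * Real.exp (α * δ)) * (δ * r (t - a)) := by ring
        _ = δ * r (t - a) := by rw [← Real.exp_add]; simp
    have h3 : S₂ ≤ B * δ := by
      have : S₂ ≤ ∫ _ in (t - (a - δ) - δ)..(t - (a - δ)), B :=
        intervalIntegral.integral_mono_on (by linarith) (hint _ _) (by simp) fun u _ => hB u
      rw [intervalIntegral.integral_const, smul_eq_mul, sub_sub_cancel] at this
      linarith
    have h4 : Real.exp (-α * δ) ≤ Real.exp (α * δ) := Real.exp_le_exp.2 (by nlinarith)
    have h5 : δ * (r t - r (t - a)) < δ * κ := by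
      calc δ * (r t - r (t - a))
          ≤ Real.exp (α * δ) * S₁ - Real.exp (-α * δ) * S₂ := by linarith
        _ = δ * ((S₁ - S₂) * (Real.exp (α * δ) / δ))
              + (Real.exp (α * δ) - Real.exp (-α * δ)) * S₂ := by field_simp; ring
        _ ≤ δ * ((S₁ - S₂) * (Real.exp (α * δ) / δ))
              + (Real.exp (α * δ) - Real.exp (-α * δ)) * (B * δ) := by
            gcongr
        _ = δ * ((S₁ - S₂) * (Real.exp (α * δ) / δ)
              + (Real.exp (α * δ) - Real.exp (-α * δ)) * B) := by ring
        _ < δ * (κ / 2 + κ / 2) := by gcongr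
        _ = δ * κ := by ring
    exact lt_of_mul_lt_mul_left h5 hδ.le
  refine tendsto_order.2 ⟨fun κ hκ => ?_, fun κ hκ => key a κ hκ⟩
  have := (tendsto_atTop_add_const_right atTop (-a) tendsto_id).eventually
    (key (-a) (-κ) (neg_pos.2 hκ))
  filter_upwards [this] with t ht
  simp only [id, sub_neg_eq_add, ← sub_eq_add_neg, sub_add_cancel] at ht
  linarith

/-- The renewal theorem for a solution `r` of the renewal equation `r - η * r = g`,
with `g` integrable and `exp (-α t) * r t` nonincreasing. -/
theorem tendsto_atTop_of_integrable_sub_average {η : Measure ℝ} [IsProbabilityMeasure η]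
    (hη : IsNonarithmetic η) {r : ℝ → ℝ} {α : ℝ} (hα : 0 < α) (hr0 : ∀ t, 0 ≤ r t)
    (hanti : Antitone fun t => Real.exp (-α * t) * r t)
    (hr1 : ∀ t, r t ≤ Real.exp (α * t))
    (hrK : ∀ ε, 0 < ε → ε < α → ∃ K, ∀ t, r t ≤ K * Real.exp (ε * t))
    (hid : Integrable (fun x : ℝ => x) η) (hpos : 0 < ∫ x, x ∂η)
    (hexp : Integrable (fun x => Real.exp (-(α / 2) * x)) η)
    (hg : Integrable fun t => r t - ∫ x, r (t - x) ∂η) :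
    Tendsto r atTop (𝓝 ((∫ t, (r t - ∫ x, r (t - x) ∂η)) / ∫ x, x ∂η)) := by
  have hmeas : Measurable r := by
    have : r = fun t => Real.exp (α * t) * (Real.exp (-α * t) * r t) := by
      ext t
      rw [← mul_assoc, ← Real.exp_add]
      simp
    rw [this]
    exact (by fun_prop : Measurable fun t => Real.exp (α * t)).mul hanti.measurable
  obtain ⟨ε, hε, hεα, hexpε, hφ⟩ :=
    exists_integral_exp_neg_mul_lt_one (half_pos hα) hid hpos hexp
  obtain ⟨K, hK⟩ := hrK ε hε (by linarith)
  -- The boundedness lemma needs a growth rate strictly below `ε`.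
  obtain ⟨K', hK'⟩ := hrK (ε / 2) (by linarith) (by linarith)
  obtain ⟨B, hB⟩ := exists_forall_le_of_integrable_sub_average hα hε (half_lt_self hε) hr0 hmeas
    hanti hr1 hK' hexpε hφ hg
  have hB0 : 0 ≤ B := (hr0 0).trans (hB 0)
  have hrB : ∀ t, ‖r t‖ ≤ B := fun t => by rw [Real.norm_of_nonneg (hr0 t)]; exact hB t
  have hint : ∀ a b, IntervalIntegrable r volume a b := fun a b =>
    (intervalIntegrable_const (c := B)).mono_fun' hmeas.aestronglyMeasurable (ae_of_all _ hrB)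
  have hVbd : ∀ a b, |∫ u in a..b, r u| ≤ B * |b - a| := fun a b =>
    intervalIntegral.norm_integral_le_of_norm_le_const fun x _ => hrB x
  set V : ℝ → ℝ := fun t => ∫ u in 0..t, r u with hV
  have hVsub : ∀ a b, ∫ u in a..b, r u = V b - V a := fun a b =>
    (intervalIntegral.integral_interval_sub_left (hint _ _) (hint _ _)).symm
  have hVL : LipschitzWith B.toNNReal V := by
    refine LipschitzWith.of_dist_le_mul fun x y => ?_
    rw [Real.dist_eq, Real.dist_eq, ← hVsub, Real.coe_toNNReal _ hB0]
    exact hVbd y x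
  set G : ℝ → ℝ := fun T => ∫ t in Iic T, (r t - ∫ x, r (t - x) ∂η) with hG
  have hGlim : Tendsto G atTop (𝓝 (∫ t, (r t - ∫ x, r (t - x) ∂η))) :=
    (aecover_Iic tendsto_id).integral_tendsto_of_countably_generated hg
  have hGeq : ∀ T, G T = ∫ x, (V T - V (T - x)) ∂η := fun T => by
    simp only [hG, ← hVsub]
    exact setIntegral_Iic_sub_average hε hr0 hmeas hK hexpε T
  have hVcont : ∀ T, Continuous fun x => V (T - x) := fun T =>
    hVL.continuous.comp (by fun_prop : Continuous fun x : ℝ => T - x)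
  have hVint : ∀ T, Integrable (fun x => V T - V (T - x)) η := fun T => by
    refine (hid.abs.const_mul B).mono' ((continuous_const.sub (hVcont T)).aestronglyMeasurable)
      (ae_of_all _ fun x => ?_)
    rw [← hVsub]
    simpa using hVbd (T - x) T
  have hslow : ∀ δ a : ℝ, Tendsto (fun t => (∫ u in (t - δ)..t, r u)
      - ∫ u in (t - a - δ)..(t - a), r u) atTop (𝓝 0) := by
    intro δ a
    set s : ℝ → ℝ := fun t => ∫ u in (t - δ)..t, r u with hs
    have hsb : ∀ t, |s t| ≤ B * |δ| := fun t => by simpa using hVbd (t - δ) t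
    have hsL : LipschitzWith (B.toNNReal + B.toNNReal) s := by
      refine LipschitzWith.of_dist_le_mul fun x y => ?_
      have h1 := hVL.dist_le_mul x y
      have h2 := hVL.dist_le_mul (x - δ) (y - δ)
      rw [dist_sub_right] at h2
      have h3 := dist_sub_sub_le (V x) (V (x - δ)) (V y) (V (y - δ))
      push_cast at *
      simp only [hs, hVsub]
      linarith
    refine tendsto_sub_shift_of_isNonarithmetic hη hsb hsL ?_ a
    have hsint : ∀ t, Integrable (fun x => s (t - x)) η := fun t => by
      refine Integrable.mono' (integrable_const (B * |δ|)) ?_ (ae_of_all _ fun x => hsb _)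
      exact (hsL.continuous.comp
        (by fun_prop : Continuous fun x : ℝ => t - x)).aestronglyMeasurable
    -- The defect `s t - ∫ x, s (t - x) ∂η` equals `G t - G (t - δ)`, a difference of two quantities
    -- with the same limit.
    have h1 := hGlim.sub (hGlim.comp (tendsto_atTop_add_const_right atTop (-δ) tendsto_id))
    rw [sub_self] at h1
    refine h1.congr fun t => ?_
    simp only [Function.comp, id, ← sub_eq_add_neg]
    rw [hGeq, hGeq, ← integral_sub (hVint _) (hVint _)]
    have h2 : s t - ∫ x, s (t - x) ∂η = ∫ x, (s t - s (t - x)) ∂η := by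
      rw [integral_sub (integrable_const _) (hsint t)]
      simp
    rw [h2]
    refine integral_congr_ae (ae_of_all _ fun x => ?_)
    simp only [hs, hVsub]
    rw [show t - x - δ = t - δ - x by ring]
    ring
  have hshift := tendsto_sub_shift_of_antitone_exp_mul hα hr0 hB hanti hint hslow
  have hdiff : Tendsto (fun T => ∫ x, (V T - V (T - x) - x * r T) ∂η) atTop (𝓝 0) := by
    have := tendsto_integral_filter_of_dominated_convergence (μ := η) (l := atTop)
      (F := fun T x => V T - V (T - x) - x * r T) (f := fun _ => 0) (fun x => 2 * B * |x|)
      (.of_forall fun T => ?_) (.of_forall fun T => ae_of_all _ fun x => ?_)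
      (hid.abs.const_mul _) (ae_of_all _ fun x => ?_)
    · simpa using this
    · exact ((continuous_const.sub (hVcont T)).sub
        (continuous_id.mul continuous_const)).aestronglyMeasurable
    · have h1 : |V T - V (T - x)| ≤ B * |x| := by
        rw [← hVsub]
        simpa using hVbd (T - x) T
      have h2 : |x * r T| ≤ B * |x| := by
        rw [abs_mul, mul_comm]
        exact mul_le_mul_of_nonneg_right (hrB T) (abs_nonneg x)
      exact (abs_sub _ _).trans (by linarith)
    -- The integrand here tends to 0 by `hshift` and is at most `2 * B` in absolute value.
    · have hrep : ∀ T, V T - V (T - x) - x * r T = ∫ v in 0..x, (r (T - v) - r T) := by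
        intro T
        have hi : IntervalIntegrable (fun v => r (T - v)) volume 0 x :=
          (intervalIntegrable_const (c := B)).mono_fun'
            (by fun_prop : Measurable fun v => r (T - v)).aestronglyMeasurable
            (ae_of_all _ fun v => hrB _)
        rw [intervalIntegral.integral_sub hi intervalIntegrable_const,
          intervalIntegral.integral_comp_sub_left (fun u => r u) T, sub_zero, hVsub]
        simp
      simp only [hrep]
      have := intervalIntegral.tendsto_integral_filter_of_dominated_convergence (μ := volume)
        (l := atTop) (a := 0) (b := x) (F := fun T v => r (T - v) - r T) (f := fun _ => 0)
        (fun _ => 2 * B) (.of_forall fun T =>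
          (by fun_prop : Measurable fun v => r (T - v) - r T).aestronglyMeasurable)
        (.of_forall fun T => ae_of_all _ fun v _ => ?_) intervalIntegrable_const
        (ae_of_all _ fun v _ => ?_)
      · simpa using this
      · exact (norm_sub_le _ _).trans (by linarith [hrB (T - v), hrB T])
      · have := (hshift v).neg
        rw [neg_zero] at this
        exact this.congr fun t => by ring
  have hfinal := (hGlim.sub hdiff).div_const (∫ x, x ∂η)
  rw [sub_zero] at hfinal
  refine hfinal.congr fun T => ?_
  rw [integral_sub (hVint T) (hid.mul_const _), ← hGeq, integral_mul_const]
  field_simp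
  ring

/-! ### The tilted law of `log C` -/

/-- The law of `log C` under the measure with density `m * C ^ α` with respect to `P`. -/
noncomputable def tiltedLogLaw {Ω : Type*} [MeasurableSpace Ω] (P : Measure Ω) (C : Ω → ℝ)
    (α m : ℝ) : Measure ℝ :=
  (P.withDensity fun ω => ((m * C ω ^ α).toNNReal : ENNReal)).map fun ω => Real.log (C ω)

section TiltedLogLaw

variable {Ω : Type*} [MeasurableSpace Ω] {P : Measure Ω} {C : Ω → ℝ} {α m : ℝ}

lemma measurable_toNNReal_mul_rpow (hCmeas : Measurable C) :
    Measurable fun ω => (m * C ω ^ α).toNNReal :=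
  ((hCmeas.pow_const α).const_mul m).real_toNNReal

lemma ae_toNNReal_smul_eq (hC : ∀ᵐ ω ∂P, 0 ≤ C ω) (hm : 0 ≤ m) (f : ℝ → ℝ) :
    (fun ω => (m * C ω ^ α).toNNReal • f (Real.log (C ω)))
      =ᵐ[P] fun ω => m * C ω ^ α * f (Real.log (C ω)) := by
  filter_upwards [hC] with ω hω
  rw [NNReal.smul_def, Real.coe_toNNReal _ (by positivity), smul_eq_mul]

lemma integral_tiltedLogLaw (hCmeas : Measurable C) (hC : ∀ᵐ ω ∂P, 0 ≤ C ω) (hm : 0 ≤ m)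
    {f : ℝ → ℝ} (hf : Measurable f) :
    ∫ x, f x ∂(tiltedLogLaw P C α m) = ∫ ω, m * C ω ^ α * f (Real.log (C ω)) ∂P := by
  rw [tiltedLogLaw, integral_map hCmeas.log.aemeasurable hf.aestronglyMeasurable,
    integral_withDensity_eq_integral_smul (measurable_toNNReal_mul_rpow hCmeas)]
  exact integral_congr_ae (ae_toNNReal_smul_eq hC hm f)

lemma integrable_tiltedLogLaw_iff (hCmeas : Measurable C) (hC : ∀ᵐ ω ∂P, 0 ≤ C ω) (hm : 0 ≤ m)
    {f : ℝ → ℝ} (hf : Measurable f) :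
    Integrable f (tiltedLogLaw P C α m)
      ↔ Integrable (fun ω => m * C ω ^ α * f (Real.log (C ω))) P := by
  rw [tiltedLogLaw, integrable_map_measure hf.aestronglyMeasurable hCmeas.log.aemeasurable,
    integrable_withDensity_iff_integrable_smul (measurable_toNNReal_mul_rpow hCmeas)]
  exact integrable_congr (ae_toNNReal_smul_eq hC hm f)

lemma isProbabilityMeasure_tiltedLogLaw (hCmeas : Measurable C) (hC : ∀ᵐ ω ∂P, 0 ≤ C ω)
    (hm : 0 ≤ m) (hint : Integrable (fun ω => C ω ^ α) P) (hone : m * ∫ ω, C ω ^ α ∂P = 1) :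
    IsProbabilityMeasure (tiltedLogLaw P C α m) := by
  refine ⟨?_⟩
  rw [tiltedLogLaw, Measure.map_apply hCmeas.log MeasurableSet.univ, preimage_univ,
    withDensity_apply _ MeasurableSet.univ, Measure.restrict_univ]
  have := ofReal_integral_eq_lintegral_ofReal (hint.const_mul m)
    (by filter_upwards [hC] with ω hω; simp only [Pi.zero_apply]; positivity)
  rw [integral_const_mul, hone] at this
  simpa [ENNReal.ofReal] using this.symm

/-- The density is positive where `C > 0`, so a lattice carrying the tilted law also carries the
conditional law. -/
lemma isNonarithmetic_tiltedLogLaw [IsFiniteMeasure P] (hCmeas : Measurable C)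
    (hC : ∀ᵐ ω ∂P, 0 ≤ C ω) (hm : 0 < m)
    (h : IsNonarithmetic ((P[|{ω | C ω ≠ 0}]).map (fun ω => Real.log (C ω)))) :
    IsNonarithmetic (tiltedLogLaw P C α m) := by
  rintro ⟨d, hd, hae⟩
  refine h ⟨d, hd, ?_⟩
  have hset : MeasurableSet {x : ℝ | ∃ k : ℤ, x = k * d} := by
    have : {x : ℝ | ∃ k : ℤ, x = k * d} = range fun k : ℤ => (k : ℝ) * d := by
      ext x; simp [eq_comm]
    rw [this]
    exact (countable_range _).measurableSet
  rw [ae_map_iff hCmeas.log.aemeasurable hset]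
  have h1 := ae_of_ae_map hCmeas.log.aemeasurable hae
  rw [ae_withDensity_iff (measurable_toNNReal_mul_rpow hCmeas).coe_nnreal_ennreal] at h1
  have hne : MeasurableSet {ω | C ω ≠ 0} := hCmeas (measurableSet_singleton 0).compl
  filter_upwards [cond_absolutelyContinuous.ae_le h1, cond_absolutelyContinuous.ae_le hC,
    ae_cond_mem hne] with ω h2 h3 h4
  apply h2
  have : 0 < m * C ω ^ α := mul_pos hm (Real.rpow_pos_of_pos (lt_of_le_of_ne h3 (Ne.symm h4)) _)
  simpa using this

/-- The tilt turns the integrand into `m * C ^ (α / 2)`, and `C ^ (α / 2) ≤ 1 + C ^ α`. -/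
lemma integrable_exp_tiltedLogLaw [IsFiniteMeasure P] (hα : 0 < α) (hCmeas : Measurable C)
    (hC : ∀ᵐ ω ∂P, 0 ≤ C ω) (hm : 0 ≤ m) (hint : Integrable (fun ω => C ω ^ α) P) :
    Integrable (fun x => Real.exp (-(α / 2) * x)) (tiltedLogLaw P C α m) := by
  rw [integrable_tiltedLogLaw_iff hCmeas hC hm (by fun_prop)]
  refine (((integrable_const (1 : ℝ)).add hint).const_mul m).mono'
    (((hCmeas.pow_const α).const_mul m).mul
      (hCmeas.log.const_mul _).exp).aestronglyMeasurable ?_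
  filter_upwards [hC] with ω hω
  rw [Real.norm_of_nonneg (by positivity), mul_assoc]
  refine mul_le_mul_of_nonneg_left ?_ hm
  simp only [Pi.add_apply]
  rcases hω.eq_or_lt with h0 | h0
  · rw [← h0, Real.zero_rpow hα.ne']; simp
  · rw [show -(α / 2) * Real.log (C ω) = Real.log (C ω) * (-(α / 2)) by ring,
      ← Real.rpow_def_of_pos h0, ← Real.rpow_add h0, show α + -(α / 2) = α / 2 by ring]
    rcases le_total (C ω) 1 with h1 | h1
    · have := Real.rpow_le_one hω h1 (half_pos hα).le
      have := Real.rpow_nonneg hω α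
      linarith
    · have := Real.rpow_le_rpow_of_exponent_le h1 (half_le_self hα.le)
      linarith

end TiltedLogLaw

/-! ### Tails of `R` and `C * R` in exponential coordinates -/

lemma measureReal_lt_mul_eq_integral {Ω : Type*} [MeasurableSpace Ω] {P : Measure Ω}
    [IsProbabilityMeasure P] {C R : Ω → ℝ} (hCmeas : Measurable C) (hRmeas : Measurable R)
    (hind : IndepFun C R P) (v : ℝ) :
    P.real {ω | v < C ω * R ω} = ∫ ω, P.real {ω' | v < C ω * R ω'} ∂P := by
  have hS : MeasurableSet {p : ℝ × ℝ | v < p.1 * p.2} :=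
    measurableSet_lt measurable_const (by fun_prop)
  have hfib : ∀ c, (P.map R) (Prod.mk c ⁻¹' {p : ℝ × ℝ | v < p.1 * p.2})
      = P {ω' | v < c * R ω'} := fun c => by
    rw [Measure.map_apply hRmeas (measurable_prodMk_left hS)]
    rfl
  have hmeas : Measurable fun c => P {ω' | v < c * R ω'} := by
    simp_rw [← hfib]
    have := Measure.isProbabilityMeasure_map (μ := P) hRmeas.aemeasurable
    exact measurable_measure_prodMk_left hS
  have h1 : P {ω | v < C ω * R ω} = ∫⁻ ω, P {ω' | v < C ω * R ω'} ∂P := by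
    have := Measure.isProbabilityMeasure_map (μ := P) hRmeas.aemeasurable
    calc P {ω | v < C ω * R ω}
        = (P.map fun ω => (C ω, R ω)) {p : ℝ × ℝ | v < p.1 * p.2} := by
          rw [Measure.map_apply (hCmeas.prodMk hRmeas) hS]
          rfl
      _ = ∫⁻ c, P {ω' | v < c * R ω'} ∂(P.map C) := by
          rw [(indepFun_iff_map_prod_eq_prod_map_map hCmeas.aemeasurable
            hRmeas.aemeasurable).1 hind, Measure.prod_apply hS]
          simp_rw [hfib]
      _ = _ := lintegral_map hmeas hCmeas
  simp only [Measure.real]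
  rw [h1]
  exact (integral_toReal (hmeas.comp hCmeas).aemeasurable
    (ae_of_all _ fun ω => measure_lt_top _ _)).symm

lemma measureReal_exp_lt_le {Ω : Type*} [MeasurableSpace Ω] {P : Measure Ω}
    [IsProbabilityMeasure P] {R : Ω → ℝ} (hR : ∀ᵐ ω ∂P, 0 ≤ R ω) {β : ℝ} (hβ : 0 < β)
    (hint : Integrable (fun ω => R ω ^ β) P) (t : ℝ) :
    P.real {ω | Real.exp t < R ω} ≤ (∫ ω, R ω ^ β ∂P) * Real.exp (-β * t) := by
  have h1 := mul_meas_ge_le_integral_of_nonneg (μ := P) (f := fun ω => R ω ^ β)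
    (by filter_upwards [hR] with ω hω; simp only [Pi.zero_apply]; positivity) hint
    (Real.exp (β * t))
  have h2 : P.real {ω | Real.exp t < R ω} ≤ P.real {ω | Real.exp (β * t) ≤ R ω ^ β} := by
    refine measureReal_mono fun ω hω => ?_
    simp only [mem_ofPred_eq] at hω ⊢
    rw [mul_comm, Real.exp_mul]
    exact Real.rpow_le_rpow (Real.exp_pos t).le hω.le hβ.le
  calc P.real {ω | Real.exp t < R ω}
      = Real.exp (β * t) * P.real {ω | Real.exp t < R ω} * Real.exp (-β * t) := by
        rw [mul_right_comm, ← Real.exp_add]; simp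
    _ ≤ _ := by
        gcongr
        exact (mul_le_mul_of_nonneg_left h2 (Real.exp_pos _).le).trans h1

lemma antitone_measureReal_lt {Ω : Type*} [MeasurableSpace Ω] {P : Measure Ω}
    [IsFiniteMeasure P] (X : Ω → ℝ) : Antitone fun v : ℝ => P.real {ω | v < X ω} :=
  fun _ _ hvw => measureReal_mono fun _ (hω : _ < _) => hvw.trans_lt hω

lemma integral_exp_mul_measureReal_tiltedLogLaw {Ω : Type*} [MeasurableSpace Ω] {P : Measure Ω}
    [IsProbabilityMeasure P] {C R : Ω → ℝ} {α m : ℝ} (hα : 0 < α) (hCmeas : Measurable C)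
    (hRmeas : Measurable R) (hC : ∀ᵐ ω ∂P, 0 ≤ C ω) (hm : 0 ≤ m) (hind : IndepFun C R P)
    (t : ℝ) :
    ∫ x, Real.exp (α * (t - x)) * P.real {ω | Real.exp (t - x) < R ω} ∂(tiltedLogLaw P C α m)
      = Real.exp (α * t) * (m * P.real {ω | Real.exp t < C ω * R ω}) := by
  have hmeas : Measurable fun x : ℝ =>
      Real.exp (α * (t - x)) * P.real {ω | Real.exp (t - x) < R ω} :=
    (by fun_prop : Measurable fun x : ℝ => Real.exp (α * (t - x))).mul
      ((antitone_measureReal_lt R).measurable.comp (by fun_prop))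
  rw [integral_tiltedLogLaw hCmeas hC hm hmeas, measureReal_lt_mul_eq_integral hCmeas hRmeas hind,
    ← integral_const_mul, ← integral_const_mul]
  refine integral_congr_ae ?_
  filter_upwards [hC] with ω hω
  rcases hω.eq_or_lt with h0 | h0
  -- Where `C = 0` the default `log 0 = 0` is harmless: the weight `0 ^ α` vanishes, as does the
  -- tail of `0 * R` above `exp t > 0`.
  · rw [← h0, Real.zero_rpow hα.ne']
    simp [(Real.exp_pos t).not_gt]
  · have hset : {ω' | Real.exp (t - Real.log (C ω)) < R ω'}
        = {ω' | Real.exp t < C ω * R ω'} := by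
      ext ω'
      simp only [mem_ofPred_eq]
      rw [Real.exp_sub, Real.exp_log h0, div_lt_iff₀' h0]
    have hE : C ω ^ α * Real.exp (α * (t - Real.log (C ω))) = Real.exp (α * t) := by
      rw [Real.rpow_def_of_pos h0, ← Real.exp_add]; ring_nf
    rw [hset, ← hE]
    ring

lemma image_exp_univ : Real.exp '' univ = Ioi 0 := by rw [image_univ, Real.range_exp]

lemma integrableOn_Ioi_iff_integrable_exp_mul (f : ℝ → ℝ) :
    IntegrableOn f (Ioi 0) ↔ Integrable fun t => Real.exp t * f (Real.exp t) := by
  rw [← image_exp_univ, integrableOn_image_iff_integrableOn_abs_deriv_smul MeasurableSet.univ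
    (fun x _ => (Real.hasDerivAt_exp x).hasDerivWithinAt) Real.exp_injective.injOn]
  simp [integrableOn_univ]

lemma integral_Ioi_eq_integral_exp_mul (f : ℝ → ℝ) :
    ∫ v in Ioi 0, f v = ∫ t, Real.exp t * f (Real.exp t) := by
  rw [← image_exp_univ, integral_image_eq_integral_abs_deriv_smul MeasurableSet.univ
    (fun x _ => (Real.hasDerivAt_exp x).hasDerivWithinAt) Real.exp_injective.injOn]
  simp

lemma exp_mul_exp_rpow_sub_one (α t : ℝ) :
    Real.exp t * Real.exp t ^ (α - 1) = Real.exp (α * t) := by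
  rw [← Real.exp_mul, ← Real.exp_add]; ring_nf

theorem theorem1 {Ω : Type*} [MeasurableSpace Ω] (P : Measure Ω) [IsProbabilityMeasure P]
    (C R : Ω → ℝ) (hCmeas : Measurable C) (hRmeas : Measurable R)
    (hC : ∀ᵐ ω ∂P, 0 ≤ C ω) (hR : ∀ᵐ ω ∂P, 0 ≤ R ω)
    (hind : IndepFun R C P)
    (α : ℝ) (hα : 0 < α) (m : ℝ)
    -- `0 < E[C ^ α log C] < ∞`
    (hlog_int : Integrable (fun ω => C ω ^ α * Real.log (C ω)) P)
    (hlog_pos : 0 < ∫ ω, C ω ^ α * Real.log (C ω) ∂P)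
    -- the conditional distribution of `log C` given `C ≠ 0`
    (hnonarith : IsNonarithmetic ((P[|{ω | C ω ≠ 0}]).map (fun ω => Real.log (C ω))))
    (hm : m * ∫ ω, C ω ^ α ∂P = 1)
    (hRmom : ∀ β : ℝ, 0 < β → β < α → Integrable (fun ω => R ω ^ β) P)
    (hcond : IntegrableOn
      (fun t : ℝ => |P.real {ω | t < R ω} - m * P.real {ω | t < C ω * R ω}| * t ^ (α - 1))
      (Ioi 0) volume)
    (H : ℝ)
    (hH : H = 1 / (m * ∫ ω, C ω ^ α * Real.log (C ω) ∂P) *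
      ∫ v in Ioi (0 : ℝ), v ^ (α - 1) *
        (P.real {ω | v < R ω} - m * P.real {ω | v < C ω * R ω})) :
    0 ≤ H ∧ Tendsto (fun t : ℝ => t ^ α * P.real {ω | t < R ω}) atTop (𝓝 H) := by
  -- A non-integrable function has integral 0 by convention, which `hm` excludes.
  have hCα : Integrable (fun ω => C ω ^ α) P := by
    by_contra h
    rw [integral_undef h, mul_zero] at hm
    exact zero_ne_one hm
  have hm0 : 0 < m := by
    have h1 : 0 ≤ ∫ ω, C ω ^ α ∂P := integral_nonneg_of_ae <| by
      filter_upwards [hC] with ω hω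
      exact Real.rpow_nonneg hω α
    exact pos_of_mul_pos_left (hm ▸ one_pos) h1
  have hprob := isProbabilityMeasure_tiltedLogLaw hCmeas hC hm0.le hCα hm
  set η := tiltedLogLaw P C α m with hη
  set r : ℝ → ℝ := fun t => Real.exp (α * t) * P.real {ω | Real.exp t < R ω} with hr
  have htail : ∀ t, Real.exp (-α * t) * r t = P.real {ω | Real.exp t < R ω} := fun t => by
    simp only [hr]
    rw [← mul_assoc, ← Real.exp_add]
    simp
  have hgeq : ∀ t, r t - ∫ x, r (t - x) ∂η = Real.exp t * (Real.exp t ^ (α - 1) *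
      (P.real {ω | Real.exp t < R ω} - m * P.real {ω | Real.exp t < C ω * R ω})) := fun t => by
    rw [← mul_assoc, exp_mul_exp_rpow_sub_one, mul_sub,
      ← integral_exp_mul_measureReal_tiltedLogLaw hα hCmeas hRmeas hC hm0.le hind.symm]
  have hmean : ∫ x, x ∂η = m * ∫ ω, C ω ^ α * Real.log (C ω) ∂P := by
    rw [hη, integral_tiltedLogLaw hCmeas hC hm0.le measurable_id', ← integral_const_mul]
    simp_rw [mul_assoc]
  have hlim := tendsto_atTop_of_integrable_sub_average (η := η) (r := r)
    (isNonarithmetic_tiltedLogLaw hCmeas hC hm0 hnonarith) hα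
    (fun t => mul_nonneg (Real.exp_pos _).le measureReal_nonneg)
    (by
      simp only [htail]
      exact (antitone_measureReal_lt R).comp_monotone Real.exp_monotone)
    (fun t => mul_le_of_le_one_right (Real.exp_pos _).le measureReal_le_one)
    -- Markov's inequality for the moment of order `α - ε` gives growth rate `ε`.
    (fun ε hε hεα => ⟨∫ ω, R ω ^ (α - ε) ∂P, fun t => by
      have h1 := measureReal_exp_lt_le hR (sub_pos.2 hεα) (hRmom _ (sub_pos.2 hεα) (by linarith)) t
      calc r t ≤ Real.exp (α * t) * ((∫ ω, R ω ^ (α - ε) ∂P) * Real.exp (-(α - ε) * t)) := by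
            simp only [hr]
            gcongr
        _ = (∫ ω, R ω ^ (α - ε) ∂P) * (Real.exp (α * t) * Real.exp (-(α - ε) * t)) := by ring
        _ = _ := by rw [← Real.exp_add]; ring_nf⟩)
    (by
      rw [hη, integrable_tiltedLogLaw_iff hCmeas hC hm0.le measurable_id']
      simpa only [mul_assoc] using hlog_int.const_mul m)
    (by rw [hmean]; positivity)
    (integrable_exp_tiltedLogLaw hα hCmeas hC hm0.le hCα)
    (by
      simp only [hgeq]
      rw [← integrableOn_Ioi_iff_integrable_exp_mul fun v => v ^ (α - 1) *
        (P.real {ω | v < R ω} - m * P.real {ω | v < C ω * R ω})]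
      refine hcond.mono' ?_ ?_
      · exact ((measurable_id.pow_const _).mul ((antitone_measureReal_lt R).measurable.sub
          ((antitone_measureReal_lt fun ω => C ω * R ω).measurable.const_mul m))).aestronglyMeasurable
      · filter_upwards [ae_restrict_mem measurableSet_Ioi] with v hv
        rw [norm_mul, Real.norm_of_nonneg (Real.rpow_nonneg (le_of_lt hv) _), mul_comm,
          Real.norm_eq_abs])
  have hHeq : (∫ t, (r t - ∫ x, r (t - x) ∂η)) / ∫ x, x ∂η = H := by
    rw [hH, integral_Ioi_eq_integral_exp_mul, hmean]
    simp only [hgeq]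
    rw [one_div, inv_mul_eq_div]
  rw [hHeq] at hlim
  have htend : Tendsto (fun t : ℝ => t ^ α * P.real {ω | t < R ω}) atTop (𝓝 H) := by
    refine (hlim.comp Real.tendsto_log_atTop).congr' ?_
    filter_upwards [eventually_gt_atTop 0] with t ht
    simp only [hr, Function.comp]
    rw [Real.exp_log ht, mul_comm α, ← Real.rpow_def_of_pos ht]
  refine ⟨ge_of_tendsto htend ?_, htend⟩
  filter_upwards [eventually_ge_atTop 0] with t ht
  positivity
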